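/- For an ordinal $\alpha$, the $\alpha$-bicyclic monoid $\mathcal B_\alpha$ is the set $\omega^\alpha\times\omega^\alpha$ of all pairs of ordinals smaller than $\omega^\alpha$, with the operation $(a,b)\cdot(c,d)=(a+(c-b),d)$ if $b\le c$ and $(a,b)\cdot(c,d)=(a,d+(b-c))$ if $b>c$, where for $y\le x$ the ordinal $x-y$ is the unique $z$ with $x=y+z$. A topology on $\mathcal B_\alpha$ is shift-continuous if for all $s,t\in\mathcal B_\alpha$ the map $x\mapsto s\,x\,t$ is continuous. Let $1\le\alpha\le\omega$ and let $\tau$ be a locally compact Hausdorff shift-continuous topology on $\mathcal B_\alpha$. Then there is an ordinal $i$ with $1\le i\le\alpha$ such that $\tau=\tau_{i,\alpha}$; that is, $\tau$ satisfies the following two conditions, and it is the only locally compact Hausdorff shift-continuous topology on $\mathcal B_\alpha$ that satisfies them: (i) for every integer $j$ with $i\le j<\alpha$, the point $(\omega^j,\omega^j)$ is isolated; (ii) for every integer $j$ with $0<j<i$, the sets $$U_n=\{(a,b): a,b<\omega^j \text{ and } (a>n\omega^{j-1}\text{ or }b>n\omega^{j-1})\}\cup\{(\omega^j,\omega^j)\},\qquad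 n=1,2,3,\dots,$$ form a base of (not necessarily open) neighbourhoods of $(\omega^j,\omega^j)$. Here $n\omega^{j-1}$ denotes the sum $\omega^{j-1}+\dots+\omega^{j-1}$ of $n$ copies of $\omega^{j-1}$. -/

import Mathlib

open Ordinal Topology

universe u

/-- The underlying set `ω ^ α × ω ^ α` of the `α`-bicyclic monoid, where the ordinal `ω ^ α` is
regarded as the set of all smaller ordinals. -/
@[ext]
structure BicyclicMonoid (α : Ordinal.{u}) : Type (u + 1) where
  fst : Ordinal.{u}
  snd : Ordinal.{u}
  fst_lt : fst < ω ^ α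
  snd_lt : snd < ω ^ α

namespace BicyclicMonoid

variable {α : Ordinal.{u}}

theorem add_sub_lt {a b c : Ordinal.{u}} (ha : a < ω ^ α) (hc : c < ω ^ α) :
    a + (c - b) < ω ^ α :=
  isPrincipal_add_omega0_opow α ha ((Ordinal.sub_le_self c b).trans_lt hc)

/-- `(a, b) * (c, d)` is `(a + (c - b), d)` if `b ≤ c`, and `(a, d + (b - c))` if `b > c`. -/
noncomputable instance : Mul (BicyclicMonoid α) where
  mul x y :=
    if x.snd ≤ y.fst then
      ⟨x.fst + (y.fst - x.snd), y.snd, add_sub_lt x.fst_lt y.fst_lt, y.snd_lt⟩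
    else
      ⟨x.fst, y.snd + (x.snd - y.fst), x.fst_lt, add_sub_lt y.snd_lt x.snd_lt⟩

noncomputable instance : One (BicyclicMonoid α) where
  one := ⟨0, 0, opow_pos α omega0_pos, opow_pos α omega0_pos⟩

theorem one_fst : (1 : BicyclicMonoid α).fst = 0 := rfl

theorem one_snd : (1 : BicyclicMonoid α).snd = 0 := rfl

theorem mul_fst (x y : BicyclicMonoid α) : (x * y).fst = x.fst + (y.fst - x.snd) := by
  change (ite _ _ _ : BicyclicMonoid α).fst = _
  split_ifs with h
  · rfl
  · simp [Ordinal.sub_eq_zero_iff_le.2 (not_le.1 h).le]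

theorem mul_snd (x y : BicyclicMonoid α) : (x * y).snd = y.snd + (x.snd - y.fst) := by
  change (ite _ _ _ : BicyclicMonoid α).snd = _
  split_ifs with h
  · simp [Ordinal.sub_eq_zero_iff_le.2 h]
  · rfl

theorem assoc_aux (a b c d e : Ordinal.{u}) :
    a + (c - b) + (e - (d + (b - c))) = a + (c + (e - d) - b) := by
  rcases le_total b c with h | h
  · obtain ⟨r, rfl⟩ := exists_add_of_le h
    simp [Ordinal.sub_eq_zero_iff_le.2 h, add_assoc]
  · obtain ⟨r, rfl⟩ := exists_add_of_le h
    rw [Ordinal.sub_eq_zero_iff_le.2 h, Ordinal.add_sub_cancel, Ordinal.add_sub_add_cancel,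
      add_zero, Ordinal.sub_sub]

noncomputable instance : Monoid (BicyclicMonoid α) where
  mul_assoc x y z := by
    ext
    · simp only [mul_fst, mul_snd]
      exact assoc_aux _ _ _ _ _
    · simp only [mul_fst, mul_snd]
      exact (assoc_aux _ _ _ _ _).symm
  one_mul x := by
    ext <;> simp [mul_fst, mul_snd, one_fst, one_snd]
  mul_one x := by
    ext <;> simp [mul_fst, mul_snd, one_fst, one_snd]

/-- The point `(ω ^ j, ω ^ j)`. -/
noncomputable def diag (j : ℕ) (hj : (j : Ordinal.{u}) < α) : BicyclicMonoid α where
  fst := ω ^ (j : Ordinal.{u})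
  snd := ω ^ (j : Ordinal.{u})
  fst_lt := (opow_lt_opow_iff_right one_lt_omega0).2 hj
  snd_lt := (opow_lt_opow_iff_right one_lt_omega0).2 hj

/-- The point `(ω ^ j, ω ^ j)` together with the pairs `(a, b)` such that `a, b < ω ^ j` and one of
`a`, `b` exceeds the `n`-fold sum `ω ^ (j - 1) + ⋯ + ω ^ (j - 1)`; used for `1 ≤ j` only. -/
def basicNhd (j : ℕ) (hj : (j : Ordinal.{u}) < α) (n : ℕ) : Set (BicyclicMonoid α) :=
  {x | x.fst < ω ^ (j : Ordinal.{u}) ∧ x.snd < ω ^ (j : Ordinal.{u}) ∧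
    (ω ^ ((j - 1 : ℕ) : Ordinal.{u}) * (n : Ordinal.{u}) < x.fst ∨
      ω ^ ((j - 1 : ℕ) : Ordinal.{u}) * (n : Ordinal.{u}) < x.snd)} ∪ {diag j hj}

/-- All two-sided shifts `x ↦ a * x * b` are continuous. -/
def ShiftContinuous {S : Type*} [Monoid S] (τ : TopologicalSpace S) : Prop :=
  ∀ a b : S, Continuous[τ, τ] fun x => a * x * b

/-- Locally compact Hausdorff shift-continuous topologies on a monoid. -/
structure IsLCShiftTopology {S : Type*} [Monoid S] (τ : TopologicalSpace S) : Prop where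
  t2 : @T2Space S τ
  locallyCompact : @LocallyCompactSpace S τ
  shift : ShiftContinuous τ

/-- The conditions that determine the topology `τ_{i,α}`. -/
structure IsTau (α i : Ordinal.{u}) (τ : TopologicalSpace (BicyclicMonoid α)) : Prop where
  lcShift : IsLCShiftTopology τ
  isolated : ∀ (j : ℕ) (hj : (j : Ordinal.{u}) < α), i ≤ j → IsOpen[τ] {diag j hj}
  hasBasis : ∀ (j : ℕ) (hj : (j : Ordinal.{u}) < α), 1 ≤ j → (j : Ordinal.{u}) < i →
    (@nhds _ τ (diag j hj)).HasBasis (fun n : ℕ => 1 ≤ n) (basicNhd j hj)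

end BicyclicMonoid

/-! The Hausdorff property makes the identity (0, 0) isolated. The elements above a given point form
the preimage of the identity under a shift, hence a clopen set. So a pair without a nonzero common
tail is isolated; otherwise its least common tail is some ω^q, and a shift carries the
neighbourhoods of (ω^q, ω^q) onto those of the pair (`nhds_eq_map`). Only the points (ω^j, ω^j)
remain, and j = 0 always gives an isolated one.

Let z = (ω^(q+1), ω^(q+1)). The elements strictly above z form a submonoid of which z is a zero, and
they split into clopen cells indexed by ℕ × ℕ. A compact neighbourhood K of z inside its ball lies
in any other neighbourhood of z up to finitely many cells; since z is a zero, K is stable, up to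
finitely many cells, under each shift by the submonoid. A subset of ℕ × ℕ almost invariant under the
coordinate shifts is finite or cofinite, so if z is not isolated, K meets almost every cell, and
then contains almost every cell (`eventually_cell_subset_compact`). This forces the prescribed base
at z.

Isolation passes from j ≥ 1 to j + 1 (`isOpen_diag_succ`): otherwise a whole cell one level up is
compact, and a shift of it is a compact set meeting almost every cell around an isolated point.
Hence i is the least positive isolated level, or α if there is none. -/

namespace BicyclicMonoid

/-! ### Algebra: one-sided generators and the natural order. -/

variable {α : Ordinal.{u}}

/-- The element `(a, 0)`. -/
noncomputable def inl (a : Ordinal.{u}) (ha : a < ω ^ α) : BicyclicMonoid α :=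
  ⟨a, 0, ha, opow_pos α omega0_pos⟩

/-- The element `(0, a)`. -/
noncomputable def inr (a : Ordinal.{u}) (ha : a < ω ^ α) : BicyclicMonoid α :=
  ⟨0, a, opow_pos α omega0_pos, ha⟩

section algebra

variable {a b : Ordinal.{u}} (ha : a < ω ^ α) (hb : b < ω ^ α) (x : BicyclicMonoid α)

@[simp] theorem inl_fst : (inl a ha).fst = a := rfl
@[simp] theorem inl_snd : (inl a ha).snd = 0 := rfl
@[simp] theorem inr_fst : (inr a ha).fst = 0 := rfl
@[simp] theorem inr_snd : (inr a ha).snd = a := rfl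
@[simp] theorem diag_fst (j : ℕ) (hj : (j : Ordinal.{u}) < α) :
    (diag j hj).fst = ω ^ (j : Ordinal.{u}) := rfl
@[simp] theorem diag_snd (j : ℕ) (hj : (j : Ordinal.{u}) < α) :
    (diag j hj).snd = ω ^ (j : Ordinal.{u}) := rfl

theorem add_lt {a b : Ordinal.{u}} (ha : a < ω ^ α) (hb : b < ω ^ α) : a + b < ω ^ α :=
  isPrincipal_add_omega0_opow α ha hb

theorem inl_mul_inl : inl a ha * inl b hb = inl (a + b) (add_lt ha hb) := by
  ext <;> simp [mul_fst, mul_snd]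

theorem inr_mul_inr : inr a ha * inr b hb = inr (b + a) (add_lt hb ha) := by
  ext <;> simp [mul_fst, mul_snd]

theorem inr_mul_inl : inr a ha * inl a ha = 1 := by
  ext <;> simp [mul_fst, mul_snd, one_fst, one_snd]

theorem inl_mul_inr : inl a ha * inr b hb = ⟨a, b, ha, hb⟩ := by
  ext <;> simp [mul_fst, mul_snd]

theorem inl_mul_fst : (inl a ha * x).fst = a + x.fst := by simp [mul_fst]
theorem inl_mul_snd : (inl a ha * x).snd = x.snd := by simp [mul_snd]
theorem mul_inr_fst : (x * inr b hb).fst = x.fst := by simp [mul_fst]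
theorem mul_inr_snd : (x * inr b hb).snd = b + x.snd := by simp [mul_snd]

theorem inl_mul_inr_mul (h : a ≤ x.fst) : inl a ha * (inr a ha * x) = x := by
  ext
  · rw [inl_mul_fst, mul_fst]; simp [Ordinal.add_sub_cancel_of_le h]
  · rw [inl_mul_snd, mul_snd]; simp [Ordinal.sub_eq_zero_iff_le.2 h]

theorem mul_inl_mul_inr (h : b ≤ x.snd) : x * inl b hb * inr b hb = x := by
  ext
  · rw [mul_inr_fst, mul_fst]; simp [Ordinal.sub_eq_zero_iff_le.2 h]
  · rw [mul_inr_snd, mul_snd]; simp [Ordinal.add_sub_cancel_of_le h]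

/-- The elements above `(a, b)` in the natural order. -/
def upset : Set (BicyclicMonoid α) := {x | inr a ha * x * inl b hb = 1}

variable {x}

theorem mem_upset : x ∈ upset ha hb ↔ ∃ r, x.fst + r = a ∧ x.snd + r = b := by
  rw [upset, Set.mem_ofPred_eq, BicyclicMonoid.ext_iff]
  simp only [mul_fst, mul_snd, inr_fst, inr_snd, inl_fst, inl_snd, zero_add, one_fst, one_snd]
  constructor
  · rintro ⟨h, h'⟩
    have h0 : x.fst - a = 0 := by
      by_contra h0
      exact h0 (by simpa using (le_self_add.trans h.le : x.fst - a ≤ 0))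
    rw [h0, zero_add] at h
    refine ⟨a - x.fst, Ordinal.add_sub_cancel_of_le (Ordinal.sub_eq_zero_iff_le.1 h0), ?_⟩
    exact (Ordinal.sub_eq_zero_iff_le.1 h').antisymm (Ordinal.sub_eq_zero_iff_le.1 h)
  · rintro ⟨r, rfl, rfl⟩
    have : x.fst - (x.fst + r) = 0 := Ordinal.sub_eq_zero_iff_le.2 le_self_add
    simp [this]

end algebra

/-! ### Tails of ordinals. -/

section ordinals

theorem tail_opow {q s : Ordinal.{u}} (h : s < ω ^ q) : s + ω ^ q = ω ^ q :=
  add_omega0_opow h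

theorem opow_tail {q a r : Ordinal.{u}} (h : a + r = ω ^ q) (hr : r ≠ 0) :
    a < ω ^ q ∧ r = ω ^ q := by
  have ha : a < ω ^ q := h ▸ lt_add_of_pos_right a (pos_iff_ne_zero.2 hr)
  refine ⟨ha, ?_⟩
  rw [← tail_opow ha] at h
  exact add_left_cancel h

theorem opow_succ_nat (q : ℕ) :
    (ω : Ordinal.{u}) ^ ((q + 1 : ℕ) : Ordinal.{u}) = ω ^ (q : Ordinal.{u}) * ω := by
  rw [Nat.cast_succ, ← Order.succ_eq_add_one, opow_succ]

theorem opow_mul_nat_lt (q k : ℕ) :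
    (ω : Ordinal.{u}) ^ (q : Ordinal.{u}) * k < ω ^ ((q + 1 : ℕ) : Ordinal.{u}) := by
  rw [opow_succ_nat]
  exact (mul_lt_mul_iff_right₀ (opow_pos _ omega0_pos)).2 (natCast_lt_omega0 k)

theorem opow_mul_nat_lt' {q : ℕ} (hq : (q : Ordinal.{u}) < α) (k : ℕ) :
    (ω : Ordinal.{u}) ^ (q : Ordinal.{u}) * k < ω ^ α := by
  refine (opow_mul_nat_lt q k).trans_le (opow_le_opow_right omega0_pos ?_)
  rw [Nat.cast_succ]
  exact Order.add_one_le_of_lt hq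

theorem exists_opow_mul_nat_add {q : ℕ} {a : Ordinal.{u}}
    (h : a < ω ^ ((q + 1 : ℕ) : Ordinal.{u})) :
    ∃ (m : ℕ) (s : Ordinal.{u}), s < ω ^ (q : Ordinal.{u}) ∧
      a = ω ^ (q : Ordinal.{u}) * m + s := by
  have hp : (ω : Ordinal.{u}) ^ (q : Ordinal.{u}) ≠ 0 := (opow_pos _ omega0_pos).ne'
  rw [opow_succ_nat] at h
  obtain ⟨m, hm⟩ := lt_omega0.1 ((Ordinal.lt_mul_iff_div_lt hp).1 h)
  exact ⟨m, a % ω ^ (q : Ordinal.{u}), mod_lt _ hp, by rw [← hm, div_add_mod]⟩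

theorem add_opow_mul_succ {q s : Ordinal.{u}} (h : s < ω ^ q) (m e : ℕ) :
    ω ^ q * m + s + ω ^ q * ((e + 1 : ℕ) : Ordinal.{u}) =
      ω ^ q * ((m + e + 1 : ℕ) : Ordinal.{u}) := by
  have h1 : ((e + 1 : ℕ) : Ordinal.{u}) = 1 + e := by rw [add_comm]; simp
  have h2 : ((m + e + 1 : ℕ) : Ordinal.{u}) = m + (1 + e) := by
    rw [add_assoc, add_comm e 1]; simp
  rw [h1, h2, mul_add, mul_add, mul_add, mul_one, add_assoc, ← add_assoc s, tail_opow h]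

/-- The nonzero tails of `ω ^ q * k`. -/
theorem opow_mul_nat_tail {q k : ℕ} {a r : Ordinal.{u}}
    (h : a + r = ω ^ (q : Ordinal.{u}) * k) (hr : r ≠ 0) :
    ∃ (m e : ℕ) (s : Ordinal.{u}), s < ω ^ (q : Ordinal.{u}) ∧
      a = ω ^ (q : Ordinal.{u}) * m + s ∧
      r = ω ^ (q : Ordinal.{u}) * ((e + 1 : ℕ) : Ordinal.{u}) ∧ k = m + e + 1 := by
  have hak : a < ω ^ (q : Ordinal.{u}) * k := h ▸ lt_add_of_pos_right a (pos_iff_ne_zero.2 hr)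
  obtain ⟨m, s, hs, rfl⟩ := exists_opow_mul_nat_add (hak.trans (opow_mul_nat_lt q k))
  have hm : m < k := by
    have := le_self_add.trans_lt hak
    rw [mul_lt_mul_iff_right₀ (opow_pos _ omega0_pos)] at this
    exact_mod_cast this
  obtain ⟨e, rfl⟩ := Nat.exists_eq_add_of_lt hm
  refine ⟨m, e, s, hs, rfl, ?_, rfl⟩
  rw [← add_opow_mul_succ hs] at h
  exact add_left_cancel h

/-- A minimal nonzero common tail of two ordinals is a power of `ω`. -/
theorem exists_opow_common_tail {a b r : Ordinal.{u}} (hr : r ≠ 0) (ha : ∃ c, c + r = a)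
    (hb : ∃ d, d + r = b) :
    ∃ q c d : Ordinal.{u}, a = ω ^ q * c + ω ^ q ∧ b = ω ^ q * d + ω ^ q := by
  let T : Set Ordinal.{u} := {r | r ≠ 0 ∧ (∃ c, c + r = a) ∧ ∃ d, d + r = b}
  have hT : T.Nonempty := ⟨r, hr, ha, hb⟩
  obtain ⟨h0, ⟨c, hc⟩, ⟨d, hd⟩⟩ := csInf_mem hT
  set t := sInf T with ht
  -- A nonzero tail of t is again a common tail, so it equals t by minimality. Hence u + t = t for
  -- every u < t, which makes t additively principal.
  have hmin : ∀ u v, u + v = t → v ≠ 0 → v = t := fun u v huv hv =>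
    le_antisymm (huv ▸ le_add_self) (csInf_le' ⟨hv, ⟨c + u, by rw [add_assoc, huv, hc]⟩,
      ⟨d + u, by rw [add_assoc, huv, hd]⟩⟩)
  have hp : IsPrincipal (· + ·) t := by
    intro u v hu hv
    have h1 := hmin u (t - u) (Ordinal.add_sub_cancel_of_le hu.le) (by
      rw [Ne, Ordinal.sub_eq_zero_iff_le]; exact hu.not_ge)
    have h2 : u + t = t := by conv_rhs => rw [← Ordinal.add_sub_cancel_of_le hu.le, h1]
    calc u + v < u + t := by simpa using hv
      _ = t := h2
  obtain h | ⟨q, hq⟩ := isPrincipal_add_iff_zero_or_omega0_opow.1 hp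
  · exact absurd h h0
  have hω : (ω : Ordinal.{u}) ^ q ≠ 0 := (opow_pos _ omega0_pos).ne'
  -- The remainder of e modulo ω^q is absorbed by the following ω^q.
  have key : ∀ e, e + ω ^ q = ω ^ q * (e / ω ^ q) + ω ^ q := fun e => by
    conv_lhs => rw [← div_add_mod e (ω ^ q), add_assoc, tail_opow (mod_lt _ hω)]
  replace hq : ω ^ q = t := hq
  exact ⟨q, c / ω ^ q, d / ω ^ q, by rw [← key, hq, hc], by rw [← key, hq, hd]⟩

theorem add_opow_mul {q s n : Ordinal.{u}} (h : s < ω ^ q) (hn : n ≠ 0) :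
    s + ω ^ q * n = ω ^ q * n := by
  rw [← Ordinal.add_sub_cancel_of_le (Order.one_le_iff_ne_zero.2 hn), mul_add, mul_one, ← add_assoc,
    tail_opow h]

/-- The tail from a to ω^q c is ω^q n with n ≠ 0, so r = ω^q n + ω^q. Since b + ω^q n is a multiple
of ω^q, the final ω^q cancels in the second equation too. In the natural order: nothing above the
larger point can fall short of the smaller one in a coordinate without being above it. -/
theorem exists_add_eq_of_lt {q a b c d r : Ordinal.{u}} (h : a + r = ω ^ q * c + ω ^ q)
    (h' : b + r = ω ^ q * d + ω ^ q) (hlt : a < ω ^ q * c) :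
    ∃ e, a + e = ω ^ q * c ∧ b + e = ω ^ q * d := by
  have hω : (ω : Ordinal.{u}) ^ q ≠ 0 := (opow_pos _ omega0_pos).ne'
  have ha := div_add_mod a (ω ^ q)
  have hb := div_add_mod b (ω ^ q)
  have hm : a / ω ^ q < c := (Ordinal.lt_mul_iff_div_lt hω).1 hlt
  obtain ⟨n, hn⟩ := exists_add_of_le hm.le
  have hn0 : n ≠ 0 := by rintro rfl; simp [hn] at hm
  have hae : a + ω ^ q * n = ω ^ q * c := by
    rw [← ha, add_assoc, add_opow_mul (mod_lt _ hω) hn0, ← mul_add, ← hn]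
  have hbe : b + ω ^ q * n = ω ^ q * (b / ω ^ q + n) := by
    conv_lhs => rw [← hb, add_assoc, add_opow_mul (mod_lt _ hω) hn0, ← mul_add]
  refine ⟨_, hae, ?_⟩
  have hr : r = ω ^ q * n + ω ^ q := by
    rw [← hae, add_assoc] at h
    exact add_left_cancel h
  rw [hr, ← add_assoc, hbe] at h'
  rw [hbe]
  rw [← mul_add_one, ← mul_add_one] at h'
  have := mul_left_cancel₀ hω h'
  rw [← Order.succ_eq_add_one, ← Order.succ_eq_add_one, Order.succ_eq_succ_iff] at this
  rw [this]

theorem eq_add_opow_of_ne_zero {a : Ordinal.{u}} (ha : a ≠ 0) :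
    ∃ q c : Ordinal.{u}, c < a ∧ a = c + ω ^ q := by
  obtain ⟨q, c, d, h, -⟩ := exists_opow_common_tail ha ⟨0, zero_add a⟩ ⟨0, zero_add a⟩
  exact ⟨q, _, by conv_rhs => rw [h]
                  exact lt_add_of_pos_right _ (opow_pos _ omega0_pos), h⟩

end ordinals

/-! ### Neighbourhoods forced by shift-continuity. -/

section nhds

variable [τ : TopologicalSpace (BicyclicMonoid α)] [T2Space (BicyclicMonoid α)]

/-- Multiplying by the idempotent (1, 1) on the left fixes exactly the pairs with nonzero first
coordinate, on the right those with nonzero second coordinate. Both fixed-point sets are closed, and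
together they miss only the identity. -/
theorem isOpen_one (hs : ShiftContinuous τ) : IsOpen ({1} : Set (BicyclicMonoid α)) := by
  by_cases h1 : (1 : Ordinal.{u}) < ω ^ α
  · have e : ({1} : Set (BicyclicMonoid α))ᶜ =
        {x | inl 1 h1 * inr 1 h1 * x * 1 = 1 * x * 1} ∪
          {x | 1 * x * (inl 1 h1 * inr 1 h1) = 1 * x * 1} := by
      ext x
      simp only [Set.mem_compl_iff, Set.mem_singleton_iff, Set.mem_union, Set.mem_ofPred_eq,
        one_mul, mul_one]
      constructor
      · intro hx
        by_cases hf : x.fst = 0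
        · right
          rw [← mul_assoc]
          refine mul_inl_mul_inr h1 x (Order.one_le_iff_ne_zero.2 fun h => hx ?_)
          ext
          · exact hf
          · exact h
        · left
          rw [mul_assoc]
          exact inl_mul_inr_mul h1 x (Order.one_le_iff_ne_zero.2 hf)
      · rintro h rfl
        rcases h with h | h
        · simpa [inl_mul_inr, one_fst] using congrArg fst h
        · simpa [inl_mul_inr, one_fst] using congrArg fst h
    rw [← isClosed_compl_iff, e]
    exact (isClosed_eq (hs _ _) (hs _ _)).union (isClosed_eq (hs _ _) (hs _ _))
  · have : ({1} : Set (BicyclicMonoid α)) = Set.univ := by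
      ext x
      simp only [Set.mem_singleton_iff, Set.mem_univ, iff_true]
      have hf := x.fst_lt.trans_le (not_lt.1 h1)
      have hg := x.snd_lt.trans_le (not_lt.1 h1)
      ext
      · simpa [one_fst] using hf
      · simpa [one_snd] using hg
    rw [this]
    exact isOpen_univ

theorem isClopen_upset (hs : ShiftContinuous τ) {a b : Ordinal.{u}} (ha : a < ω ^ α)
    (hb : b < ω ^ α) : IsClopen (upset ha hb) :=
  IsClopen.preimage ⟨isClosed_singleton, isOpen_one hs⟩ (hs (inr a ha) (inl b hb))

/-- A point without nonzero common tail is isolated. -/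
theorem nhds_eq_pure (hs : ShiftContinuous τ) (x : BicyclicMonoid α)
    (h : ∀ r, (∃ c, c + r = x.fst) → (∃ d, d + r = x.snd) → r = 0) : 𝓝 x = pure x := by
  rw [← isOpen_singleton_iff_nhds_eq_pure]
  convert (isClopen_upset hs x.fst_lt x.snd_lt).isOpen
  ext y
  rw [mem_upset, Set.mem_singleton_iff]
  constructor
  · rintro rfl
    exact ⟨0, by simp⟩
  · rintro ⟨r, h1, h2⟩
    obtain rfl := h r ⟨_, h1⟩ ⟨_, h2⟩
    rw [add_zero] at h1 h2
    ext
    · exact h1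
    · exact h2

/-- The shift y ↦ (ω^q c, 0) y (0, ω^q d) sends (ω^q, ω^q) to x and has a continuous left inverse;
the point is that this is also a right inverse near x. -/
theorem nhds_eq_map (hs : ShiftContinuous τ) {q : ℕ} (hq : (q : Ordinal.{u}) < α)
    (x : BicyclicMonoid α) {c d : Ordinal.{u}}
    (hc : ω ^ (q : Ordinal.{u}) * c < ω ^ α) (hd : ω ^ (q : Ordinal.{u}) * d < ω ^ α)
    (hxc : x.fst = ω ^ (q : Ordinal.{u}) * c + ω ^ (q : Ordinal.{u}))
    (hxd : x.snd = ω ^ (q : Ordinal.{u}) * d + ω ^ (q : Ordinal.{u})) :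
    𝓝 x = Filter.map (fun y => inl _ hc * y * inr _ hd) (𝓝 (diag q hq)) := by
  have hφ : inl _ hc * diag q hq * inr _ hd = x := by
    ext
    · rw [mul_inr_fst, inl_mul_fst, hxc, diag_fst]
    · rw [mul_inr_snd, inl_mul_snd, hxd, diag_snd]
  have hψ : inr _ hc * x * inl _ hd = diag q hq := by
    rw [← hφ]
    calc _ = (inr _ hc * inl _ hc) * diag q hq * (inr _ hd * inl _ hd) := by simp only [mul_assoc]
      _ = _ := by rw [inr_mul_inl, inr_mul_inl, one_mul, mul_one]
  have hp := (diag q hq).fst_lt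
  rw [diag_fst] at hp
  refine le_antisymm (fun V hV => ?_) ?_
  · rw [Filter.mem_map] at hV
    have hU : upset hp hp ∈ 𝓝 (diag q hq) :=
      (isClopen_upset hs hp hp).isOpen.mem_nhds ((mem_upset _ _).2 ⟨0, by simp⟩)
    have h1 : {1}ᶜ ∈ 𝓝 (diag q hq) := isOpen_compl_singleton.mem_nhds (by
      intro h
      have := congrArg fst h
      rw [diag_fst, one_fst] at this
      exact (opow_pos _ omega0_pos).ne' this)
    have hO := (hs (inr _ hc) (inl _ hd)).continuousAt (x := x)
      (by rw [hψ]; exact Filter.inter_mem hV (Filter.inter_mem hU h1))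
    rw [Filter.mem_map] at hO
    filter_upwards [hO] with y hy
    obtain ⟨hy1, hy2, hy3⟩ := hy
    have hup : ∃ r, y.fst + r = ω ^ (q : Ordinal.{u}) * c + ω ^ (q : Ordinal.{u}) ∧
        y.snd + r = ω ^ (q : Ordinal.{u}) * d + ω ^ (q : Ordinal.{u}) := by
      rw [← mem_upset (add_lt hc hp) (add_lt hd hp), upset, Set.mem_ofPred_eq,
        ← inr_mul_inr hp hc, ← inl_mul_inl hd hp, ← hy2]
      simp only [mul_assoc]
    -- The image of y under the left inverse is not the identity, so y is not above (ω^q c, ω^q d).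
    -- As y is above x, both coordinates of y must then be large enough for the shifts to cancel.
    have hnot : ¬ ∃ r, y.fst + r = ω ^ (q : Ordinal.{u}) * c ∧
        y.snd + r = ω ^ (q : Ordinal.{u}) * d := by
      rw [← mem_upset hc hd]
      exact hy3
    obtain ⟨r, hr, hr'⟩ := hup
    have hle : ω ^ (q : Ordinal.{u}) * c ≤ y.fst :=
      not_lt.1 fun hlt => hnot (exists_add_eq_of_lt hr hr' hlt)
    have hle' : ω ^ (q : Ordinal.{u}) * d ≤ y.snd := not_lt.1 fun hlt => hnot <| by
      obtain ⟨e, h, h'⟩ := exists_add_eq_of_lt hr' hr hlt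
      exact ⟨e, h', h⟩
    have hy : inl _ hc * (inr _ hc * y * inl _ hd) * inr _ hd = y := by
      calc _ = inl _ hc * (inr _ hc * (y * inl _ hd * inr _ hd)) := by simp only [mul_assoc]
        _ = _ := by rw [mul_inl_mul_inr _ _ hle', inl_mul_inr_mul _ _ hle]
    rw [← hy]
    exact hy1
  · have := (hs (inl _ hc) (inr _ hd)).tendsto (diag q hq)
    rwa [hφ] at this

end nhds

/-! ### Uniqueness. -/

/-- For `α ≤ ω` the topology is determined by the neighbourhoods of the points `(ω ^ j, ω ^ j)`. -/
theorem eq_of_nhds_diag (hα : α ≤ ω) {τ τ' : TopologicalSpace (BicyclicMonoid α)}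
    (hτ : IsLCShiftTopology τ) (hτ' : IsLCShiftTopology τ')
    (h : ∀ (j : ℕ) (hj : (j : Ordinal.{u}) < α), @nhds _ τ (diag j hj) = @nhds _ τ' (diag j hj)) :
    τ = τ' := by
  refine TopologicalSpace.ext_nhds fun x => ?_
  by_cases hx : ∀ r, (∃ c, c + r = x.fst) → (∃ d, d + r = x.snd) → r = 0
  · rw [@nhds_eq_pure α τ hτ.t2 hτ.shift x hx, @nhds_eq_pure α τ' hτ'.t2 hτ'.shift x hx]
  · push Not at hx
    obtain ⟨r, hc, hd, hr⟩ := hx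
    obtain ⟨q, c, d, hxc, hxd⟩ := exists_opow_common_tail hr hc hd
    have hqα : q < α := by
      rw [← opow_lt_opow_iff_right one_lt_omega0]
      exact (le_add_self.trans hxc.ge).trans_lt x.fst_lt
    obtain ⟨q, rfl⟩ := lt_omega0.1 (hqα.trans_le hα)
    have hc' := (le_self_add.trans hxc.ge).trans_lt x.fst_lt
    have hd' := (le_self_add.trans hxd.ge).trans_lt x.snd_lt
    rw [@nhds_eq_map α τ hτ.t2 hτ.shift q hqα x c d hc' hd' hxc hxd,
      @nhds_eq_map α τ' hτ'.t2 hτ'.shift q hqα x c d hc' hd' hxc hxd, h]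

/-- Since ω^0 = 1, only (1, 1) and the identity lie above this point. This covers j = 0, about which
the conditions with i ≥ 1 say nothing. -/
theorem isOpen_diag_zero {τ : TopologicalSpace (BicyclicMonoid α)} (hτ : IsLCShiftTopology τ)
    (hj : ((0 : ℕ) : Ordinal.{u}) < α) : IsOpen[τ] {diag 0 hj} := by
  have := hτ.t2
  have h1 : (1 : Ordinal.{u}) < ω ^ α := by simpa using (diag 0 hj).fst_lt
  have e : {diag 0 hj} = upset h1 h1 ∩ {1}ᶜ := by
    ext x
    simp only [Set.mem_singleton_iff, Set.mem_inter_iff, mem_upset, Set.mem_compl_iff]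
    constructor
    · rintro rfl
      refine ⟨⟨0, by simp⟩, fun h => ?_⟩
      simpa [one_fst] using congrArg fst h
    · rintro ⟨⟨r, hr, hr'⟩, hx⟩
      by_cases h0 : r = 0
      · subst h0
        ext
        · simpa using hr
        · simpa using hr'
      · rw [← opow_zero ω] at hr hr'
        have h2 := (opow_tail hr h0).1
        have h3 := (opow_tail hr' h0).1
        refine absurd ?_ hx
        ext
        · simpa [one_fst] using h2
        · simpa [one_snd] using h3
  rw [e]
  exact (isClopen_upset hτ.shift h1 h1).isOpen.inter isOpen_compl_singleton

theorem IsTau.unique (hα : α ≤ ω) {i : Ordinal.{u}} {τ τ' : TopologicalSpace (BicyclicMonoid α)}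
    (h : IsTau α i τ) (h' : IsTau α i τ') : τ = τ' := by
  refine eq_of_nhds_diag hα h.lcShift h'.lcShift fun j hj => ?_
  have iso : IsOpen[τ] {diag j hj} → IsOpen[τ'] {diag j hj} →
      @nhds _ τ (diag j hj) = @nhds _ τ' (diag j hj) := fun h1 h2 => by
    rw [(@isOpen_singleton_iff_nhds_eq_pure _ τ _).1 h1,
      (@isOpen_singleton_iff_nhds_eq_pure _ τ' _).1 h2]
  obtain rfl | hj0 := Nat.eq_zero_or_pos j
  · exact iso (isOpen_diag_zero h.lcShift hj) (isOpen_diag_zero h'.lcShift hj)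
  · rcases le_or_gt i j with hi | hi
    · exact iso (h.isolated j hj hi) (h'.isolated j hj hi)
    · exact (h.hasBasis j hj hj0 hi).eq_of_same_basis (h'.hasBasis j hj hj0 hi)

/-! ### The grid of multiples of ω^q and its cells. -/

section cells

variable {q : ℕ} (hq : (q : Ordinal.{u}) < α)

theorem opow_nat_lt {q : ℕ} (hq : (q : Ordinal.{u}) < α) :
    (ω : Ordinal.{u}) ^ (q : Ordinal.{u}) < ω ^ α :=
  (opow_lt_opow_iff_right one_lt_omega0).2 hq

/-- The elements above `(ω ^ q * k, ω ^ q * l)`. -/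
def gridUpset {q : ℕ} (hq : (q : Ordinal.{u}) < α) (k l : ℕ) : Set (BicyclicMonoid α) :=
  upset (opow_mul_nat_lt' hq k) (opow_mul_nat_lt' hq l)

/-- The elements `x` such that `(ω ^ q * c.1, ω ^ q * c.2)` is the largest element of the grid
below `x`. -/
def cell {q : ℕ} (hq : (q : Ordinal.{u}) < α) (c : ℕ × ℕ) : Set (BicyclicMonoid α) :=
  {x | x ∈ gridUpset hq c.1 c.2 ∧ ∀ k l, c.1 = k + 1 → c.2 = l + 1 → x ∉ gridUpset hq k l}

/-- The set of elements above `(ω ^ j, ω ^ j)`, that is, this point and all `(a, b)` with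
`a, b < ω ^ j`. -/
def ball {j : ℕ} (hj : (j : Ordinal.{u}) < α) : Set (BicyclicMonoid α) :=
  upset (opow_nat_lt hj) (opow_nat_lt hj)

variable {x : BicyclicMonoid α}

theorem mem_gridUpset {k l : ℕ} : x ∈ gridUpset hq k l ↔
    ∃ r, x.fst + r = ω ^ (q : Ordinal.{u}) * k ∧ x.snd + r = ω ^ (q : Ordinal.{u}) * l :=
  mem_upset _ _

theorem mem_ball {j : ℕ} {hj : (j : Ordinal.{u}) < α} : x ∈ ball hj ↔
    x = diag j hj ∨ (x.fst < ω ^ (j : Ordinal.{u}) ∧ x.snd < ω ^ (j : Ordinal.{u})) := by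
  rw [ball, mem_upset]
  constructor
  · rintro ⟨r, hr, hr'⟩
    by_cases h0 : r = 0
    · left
      subst h0
      ext
      · simpa using hr
      · simpa using hr'
    · exact Or.inr ⟨(opow_tail hr h0).1, (opow_tail hr' h0).1⟩
  · rintro (rfl | ⟨h, h'⟩)
    · exact ⟨0, by simp⟩
    · exact ⟨_, tail_opow h, tail_opow h'⟩

theorem gridUpset_mono {k l e : ℕ} (h : x ∈ gridUpset hq k l) :
    x ∈ gridUpset hq (k + e) (l + e) := by
  rw [mem_gridUpset] at h ⊢
  obtain ⟨r, hr, hr'⟩ := h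
  refine ⟨r + ω ^ (q : Ordinal.{u}) * e, ?_, ?_⟩
  · rw [← add_assoc, hr, Nat.cast_add, mul_add]
  · rw [← add_assoc, hr', Nat.cast_add, mul_add]

/-- Comparing tails puts both grid points on one diagonal, along which the upsets increase; the
later one cannot be the largest grid point below x unless they agree. -/
theorem cell_aux {k l k' l' : ℕ} (h : x ∈ cell hq (k, l)) (h' : x ∈ cell hq (k', l'))
    (hle : k ≤ k') : (k, l) = (k', l') := by
  have hω : (ω : Ordinal.{u}) ^ (q : Ordinal.{u}) ≠ 0 := (opow_pos _ omega0_pos).ne'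
  obtain ⟨e, rfl⟩ := Nat.exists_eq_add_of_le hle
  obtain ⟨r, hr, hs⟩ := (mem_gridUpset hq).1 h.1
  obtain ⟨r', hr', hs'⟩ := (mem_gridUpset hq).1 h'.1
  have e1 : r' = r + ω ^ (q : Ordinal.{u}) * e := by
    dsimp only at hr hr'
    rw [Nat.cast_add, mul_add, ← hr, add_assoc] at hr'
    exact add_left_cancel hr'
  have e2 : l' = l + e := by
    dsimp only at hs hs'
    rw [e1, ← add_assoc, hs, ← mul_add] at hs'
    have := mul_left_cancel₀ hω hs'
    exact_mod_cast this.symm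
  subst e2
  cases e with
  | zero => rfl
  | succ e => exact absurd (gridUpset_mono hq h.1) (h'.2 (k + e) (l + e) rfl rfl)

theorem cell_disjoint {c c' : ℕ × ℕ} (h : x ∈ cell hq c) (h' : x ∈ cell hq c') : c = c' := by
  obtain ⟨k, l⟩ := c
  obtain ⟨k', l'⟩ := c'
  rcases le_total k k' with hk | hk
  · exact cell_aux hq h h' hk
  · exact (cell_aux hq h' h hk).symm

theorem exists_mem_cell_of_mem_gridUpset {k l : ℕ} (h : x ∈ gridUpset hq k l) :
    ∃ c, x ∈ cell hq c := by
  induction k generalizing l with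
  | zero => exact ⟨(0, l), h, fun _ _ h => by simp at h⟩
  | succ k ih =>
    -- The induction descends to the least first index that admits any second index.
    by_cases hx : ∃ l', x ∈ gridUpset hq k l'
    · obtain ⟨l', hl'⟩ := hx
      exact ih hl'
    · refine ⟨(k + 1, l), h, fun k' l' hk' _ hm => hx ⟨l', ?_⟩⟩
      obtain rfl : k = k' := by simpa using hk'
      exact hm

theorem mem_gridUpset_of_le {n : ℕ} (h : x.fst ≤ ω ^ (q : Ordinal.{u}) * n)
    (h' : x.snd ≤ ω ^ (q : Ordinal.{u}) * n) :
    ∃ k l, k ≤ n + 1 ∧ l ≤ n + 1 ∧ x ∈ gridUpset hq k l := by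
  obtain ⟨m, s, hs, hx⟩ := exists_opow_mul_nat_add (h.trans_lt (opow_mul_nat_lt q n))
  obtain ⟨m', s', hs', hx'⟩ := exists_opow_mul_nat_add (h'.trans_lt (opow_mul_nat_lt q n))
  have key : ∀ m : ℕ, ω ^ (q : Ordinal.{u}) * (m : Ordinal.{u}) ≤ ω ^ (q : Ordinal.{u}) * n →
      m ≤ n := fun m hm => by
    rw [mul_le_mul_iff_right₀ (opow_pos _ omega0_pos)] at hm
    exact_mod_cast hm
  refine ⟨m + 1, m' + 1, Nat.succ_le_succ (key m (le_self_add.trans (hx ▸ h))),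
    Nat.succ_le_succ (key m' (le_self_add.trans (hx' ▸ h'))), ?_⟩
  rw [mem_gridUpset]
  refine ⟨ω ^ (q : Ordinal.{u}) * ((0 + 1 : ℕ) : Ordinal.{u}), ?_, ?_⟩
  · rw [hx, add_opow_mul_succ hs]
  · rw [hx', add_opow_mul_succ hs']

theorem exists_mem_cell (h : x.fst < ω ^ ((q + 1 : ℕ) : Ordinal.{u}))
    (h' : x.snd < ω ^ ((q + 1 : ℕ) : Ordinal.{u})) : ∃ c, x ∈ cell hq c := by
  have key : ∀ a : Ordinal.{u}, a < ω ^ ((q + 1 : ℕ) : Ordinal.{u}) →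
      ∃ n : ℕ, ∀ m : ℕ, n ≤ m → a ≤ ω ^ (q : Ordinal.{u}) * m := fun a ha => by
    obtain ⟨m, s, hs, rfl⟩ := exists_opow_mul_nat_add ha
    refine ⟨m + 1, fun n hn => ?_⟩
    calc _ ≤ ω ^ (q : Ordinal.{u}) * m + ω ^ (q : Ordinal.{u}) := by gcongr
      _ = ω ^ (q : Ordinal.{u}) * ((m + 1 : ℕ) : Ordinal.{u}) := by
        rw [Nat.cast_succ, mul_add_one]
      _ ≤ _ := by gcongr
  obtain ⟨n, hn⟩ := key _ h
  obtain ⟨n', hn'⟩ := key _ h'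
  obtain ⟨k, l, -, -, hx⟩ := mem_gridUpset_of_le hq (hn (max n n') (le_max_left _ _))
    (hn' (max n n') (le_max_right _ _))
  exact exists_mem_cell_of_mem_gridUpset hq hx

theorem le_of_mem_gridUpset {k l : ℕ} (h : x ∈ gridUpset hq k l) :
    x.fst ≤ ω ^ (q : Ordinal.{u}) * k ∧ x.snd ≤ ω ^ (q : Ordinal.{u}) * l := by
  obtain ⟨r, hr, hr'⟩ := (mem_gridUpset hq).1 h
  exact ⟨hr ▸ le_self_add, hr' ▸ le_self_add⟩

theorem diag_notMem_gridUpset (hj : ((q + 1 : ℕ) : Ordinal.{u}) < α) (k l : ℕ) :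
    diag (q + 1) hj ∉ gridUpset hq k l := fun h =>
  (opow_mul_nat_lt q k).not_ge (le_of_mem_gridUpset hq h).1

theorem grid_mem_cell (k l : ℕ) :
    (⟨ω ^ (q : Ordinal.{u}) * k, ω ^ (q : Ordinal.{u}) * l, opow_mul_nat_lt' hq k,
      opow_mul_nat_lt' hq l⟩ : BicyclicMonoid α) ∈ cell hq (k, l) := by
  refine ⟨(mem_gridUpset hq).2 ⟨0, by simp⟩, ?_⟩
  rintro k' l' hk' - h
  dsimp only at hk'
  subst hk'
  have := (le_of_mem_gridUpset hq h).1
  dsimp only at this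
  rw [mul_le_mul_iff_right₀ (opow_pos _ omega0_pos)] at this
  have : k' + 1 ≤ k' := by exact_mod_cast this
  omega

/-- A nonzero tail from x to the grid point is ω^q (e + 1), and e > 0 would put x above the
preceding grid point on the diagonal. In particular, cells with a zero index are single points. -/
theorem mem_cell_cases {c : ℕ × ℕ} (h : x ∈ cell hq c) :
    (x.fst = ω ^ (q : Ordinal.{u}) * c.1 ∧ x.snd = ω ^ (q : Ordinal.{u}) * c.2) ∨
      ∃ (k l : ℕ) (s t : Ordinal.{u}), c = (k + 1, l + 1) ∧ s < ω ^ (q : Ordinal.{u}) ∧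
        t < ω ^ (q : Ordinal.{u}) ∧ x.fst = ω ^ (q : Ordinal.{u}) * k + s ∧
        x.snd = ω ^ (q : Ordinal.{u}) * l + t := by
  have hω : (ω : Ordinal.{u}) ^ (q : Ordinal.{u}) ≠ 0 := (opow_pos _ omega0_pos).ne'
  obtain ⟨r, hr, hr'⟩ := (mem_gridUpset hq).1 h.1
  by_cases h0 : r = 0
  · left
    subst h0
    exact ⟨by simpa using hr, by simpa using hr'⟩
  · right
    obtain ⟨m, e, s, hs, hx, he, hk⟩ := opow_mul_nat_tail hr h0
    obtain ⟨m', e', s', hs', hx', he', hl⟩ := opow_mul_nat_tail hr' h0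
    have hee : e = e' := by
      rw [he] at he'
      have := mul_left_cancel₀ hω he'
      have : e + 1 = e' + 1 := by exact_mod_cast this
      omega
    subst hee
    cases e with
    | zero => exact ⟨m, m', s, s', by ext <;> simp [hk, hl], hs, hs', hx, hx'⟩
    | succ e =>
      refine absurd ?_ (h.2 (m + e + 1) (m' + e + 1) (by omega) (by omega))
      rw [mem_gridUpset]
      refine ⟨ω ^ (q : Ordinal.{u}) * ((e + 1 : ℕ) : Ordinal.{u}), ?_, ?_⟩
      · rw [hx, add_opow_mul_succ hs]
      · rw [hx', add_opow_mul_succ hs']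

/-- The element `(ω ^ q, 0)`. -/
noncomputable abbrev up {q : ℕ} (hq : (q : Ordinal.{u}) < α) : BicyclicMonoid α :=
  inl (ω ^ (q : Ordinal.{u})) (opow_nat_lt hq)

/-- The element `(0, ω ^ q)`. -/
noncomputable abbrev down {q : ℕ} (hq : (q : Ordinal.{u}) < α) : BicyclicMonoid α :=
  inr (ω ^ (q : Ordinal.{u})) (opow_nat_lt hq)

theorem inr_succ (k : ℕ) : inr _ (opow_mul_nat_lt' hq (k + 1)) =
    inr _ (opow_mul_nat_lt' hq k) * down hq := by
  rw [down, inr_mul_inr]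
  congr 1
  rw [← mul_one_add]
  congr 1
  rw [add_comm k 1]
  simp

theorem inl_succ (k : ℕ) : inl _ (opow_mul_nat_lt' hq (k + 1)) =
    up hq * inl _ (opow_mul_nat_lt' hq k) := by
  rw [up, inl_mul_inl]
  congr 1
  rw [← mul_one_add]
  congr 1
  rw [add_comm k 1]
  simp

theorem down_mul_mem_gridUpset {k l : ℕ} :
    down hq * x ∈ gridUpset hq k l ↔ x ∈ gridUpset hq (k + 1) l := by
  simp only [gridUpset, upset, Set.mem_ofPred_eq]
  rw [inr_succ hq]
  simp only [mul_assoc]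

theorem mul_up_mem_gridUpset {k l : ℕ} :
    x * up hq ∈ gridUpset hq k l ↔ x ∈ gridUpset hq k (l + 1) := by
  simp only [gridUpset, upset, Set.mem_ofPred_eq]
  rw [inl_succ hq]
  simp only [mul_assoc]

theorem up_mul_mem_gridUpset {k l : ℕ} :
    up hq * x ∈ gridUpset hq (k + 1) l ↔ x ∈ gridUpset hq k l := by
  rw [← down_mul_mem_gridUpset hq, ← mul_assoc, inr_mul_inl, one_mul]

theorem mul_down_mem_gridUpset {k l : ℕ} :
    x * down hq ∈ gridUpset hq k (l + 1) ↔ x ∈ gridUpset hq k l := by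
  rw [← mul_up_mem_gridUpset hq, mul_assoc, inr_mul_inl, mul_one]

theorem down_mul_mem_cell {k l : ℕ} (h : x ∈ cell hq (k + 1, l)) :
    down hq * x ∈ cell hq (k, l) := by
  refine ⟨(down_mul_mem_gridUpset hq).2 h.1, fun k' l' hk hl hx => ?_⟩
  dsimp only at hk hl
  subst hk
  exact h.2 (k' + 1) l' rfl hl ((down_mul_mem_gridUpset hq).1 hx)

theorem mul_up_mem_cell {k l : ℕ} (h : x ∈ cell hq (k, l + 1)) :
    x * up hq ∈ cell hq (k, l) := by
  refine ⟨(mul_up_mem_gridUpset hq).2 h.1, fun k' l' hk hl hx => ?_⟩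
  dsimp only at hk hl
  subst hl
  exact h.2 k' (l' + 1) hk rfl ((mul_up_mem_gridUpset hq).1 hx)

theorem up_mul_mem_cell {k l : ℕ} (h : x ∈ cell hq (k, l)) :
    up hq * x ∈ cell hq (k + 1, l) := by
  refine ⟨(up_mul_mem_gridUpset hq).2 h.1, fun k' l' hk hl hx => ?_⟩
  obtain rfl : k = k' := by simpa using hk
  cases k with
  | zero =>
    have h0 := (le_of_mem_gridUpset hq hx).1
    rw [inl_mul_fst] at h0
    have := (opow_pos (q : Ordinal.{u}) omega0_pos).trans_le (le_self_add.trans h0)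
    simp at this
  | succ k => exact h.2 k l' rfl hl ((up_mul_mem_gridUpset hq).1 hx)

theorem mul_down_mem_cell {k l : ℕ} (h : x ∈ cell hq (k, l)) :
    x * down hq ∈ cell hq (k, l + 1) := by
  refine ⟨(mul_down_mem_gridUpset hq).2 h.1, fun k' l' hk hl hx => ?_⟩
  obtain rfl : l = l' := by simpa using hl
  cases l with
  | zero =>
    have h0 := (le_of_mem_gridUpset hq hx).2
    rw [mul_inr_snd] at h0
    have := (opow_pos (q : Ordinal.{u}) omega0_pos).trans_le (le_self_add.trans h0)
    simp at this
  | succ l => exact h.2 k' l hk rfl ((mul_down_mem_gridUpset hq).1 hx)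

theorem le_of_mem_cell_succ {k l : ℕ} (h : x ∈ cell hq (k + 1, l + 1)) :
    ω ^ (q : Ordinal.{u}) * k ≤ x.fst ∧ ω ^ (q : Ordinal.{u}) * l ≤ x.snd := by
  rcases mem_cell_cases hq h with ⟨h1, h2⟩ | ⟨k', l', s, t, hc, -, -, h1, h2⟩
  · rw [h1, h2]
    constructor <;> gcongr <;> simp
  · simp only [Prod.mk.injEq, Nat.add_right_cancel_iff] at hc
    obtain ⟨rfl, rfl⟩ := hc
    rw [h1, h2]
    exact ⟨le_self_add, le_self_add⟩

/-- The index k + 2 guarantees a first coordinate at least ω^q. On the cells (1, l + 1) the left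
factor (0, ω^q) collapses everything to one point. -/
theorem up_mul_down_mul {k l : ℕ} (h : x ∈ cell hq (k + 2, l + 1)) :
    up hq * (down hq * x) = x := by
  refine inl_mul_inr_mul _ _ (le_trans ?_ (le_of_mem_cell_succ hq h).1)
  conv_lhs => rw [← mul_one (ω ^ (q : Ordinal.{u}))]
  gcongr
  simp

theorem mul_up_mul_down {k l : ℕ} (h : x ∈ cell hq (k + 1, l + 2)) :
    x * up hq * down hq = x := by
  refine mul_inl_mul_inr _ _ (le_trans ?_ (le_of_mem_cell_succ hq h).2)
  conv_lhs => rw [← mul_one (ω ^ (q : Ordinal.{u}))]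
  gcongr
  simp

/-- The point `(ω ^ j, ω ^ j)` is a zero of the submonoid of all `(a, b)` with `a, b < ω ^ j`. -/
theorem mul_diag_mul {j : ℕ} (hj : (j : Ordinal.{u}) < α) {u v : BicyclicMonoid α}
    (hu : u.fst < ω ^ (j : Ordinal.{u}) ∧ u.snd < ω ^ (j : Ordinal.{u}))
    (hv : v.fst < ω ^ (j : Ordinal.{u}) ∧ v.snd < ω ^ (j : Ordinal.{u})) :
    u * diag j hj * v = diag j hj := by
  have key : ∀ a < (ω : Ordinal.{u}) ^ (j : Ordinal.{u}),
      ω ^ (j : Ordinal.{u}) - a = ω ^ (j : Ordinal.{u}) ∧ a - ω ^ (j : Ordinal.{u}) = 0 :=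
    fun a ha => ⟨Ordinal.sub_eq_of_add_eq (tail_opow ha), Ordinal.sub_eq_zero_iff_le.2 ha.le⟩
  have h1 : u * diag j hj = diag j hj := by
    ext
    · rw [mul_fst, diag_fst, (key _ hu.2).1, tail_opow hu.1]
    · rw [mul_snd, diag_snd, diag_fst, (key _ hu.2).2, add_zero]
  rw [h1]
  ext
  · rw [mul_fst, diag_snd, diag_fst, (key _ hv.1).2, add_zero]
  · rw [mul_snd, diag_snd, (key _ hv.1).1, tail_opow hv.2]

end cells

/-- A subset of `ℕ × ℕ` that is almost invariant under the coordinate shifts is finite or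
cofinite. -/
theorem eventually_cofinite_or {S : ℕ × ℕ → Prop}
    (h1 : ∀ᶠ c in Filter.cofinite, S c ↔ S (c.1 + 1, c.2))
    (h2 : ∀ᶠ c in Filter.cofinite, S c ↔ S (c.1, c.2 + 1)) :
    (∀ᶠ c in Filter.cofinite, S c) ∨ ∀ᶠ c in Filter.cofinite, ¬ S c := by
  have h := h1.and h2
  rw [Filter.eventually_cofinite] at h
  obtain ⟨N, hN⟩ : ∃ N : ℕ, ∀ k l, N ≤ k ∨ N ≤ l →
      (S (k, l) ↔ S (k + 1, l)) ∧ (S (k, l) ↔ S (k, l + 1)) := by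
    obtain ⟨M, hM⟩ := h.bddAbove
    refine ⟨max M.1 M.2 + 1, fun k l hkl => ?_⟩
    by_contra hc
    have := hM (show (k, l) ∈ _ from hc)
    rw [Prod.le_def] at this
    dsimp only at this
    omega
  -- Rows and columns beyond N are constant for S, and each such row crosses each such column, so S
  -- is constant outside the square of side N.
  have A : ∀ l, N ≤ l → ∀ k, S (k, l) ↔ S (0, l) := fun l hl k => by
    induction k with
    | zero => rfl
    | succ k ih => rw [← (hN k l (Or.inr hl)).1, ih]
  have B : ∀ k, N ≤ k → ∀ l, S (k, l) ↔ S (k, 0) := fun k hk l => by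
    induction l with
    | zero => rfl
    | succ l ih => rw [← (hN k l (Or.inl hk)).2, ih]
  have C : ∀ k l, N ≤ k ∨ N ≤ l → (S (k, l) ↔ S (N, N)) := by
    rintro k l (hk | hl)
    · rw [B k hk, ← B k hk N, A N le_rfl, ← A N le_rfl N]
    · rw [A l hl, ← A l hl N, B N le_rfl, ← B N le_rfl N]
  have D : ∀ᶠ c : ℕ × ℕ in Filter.cofinite, S c ↔ S (N, N) := by
    rw [Filter.eventually_cofinite]
    refine ((Set.finite_Iio N).prod (Set.finite_Iio N)).subset fun c hc => ?_
    by_contra hcN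
    refine hc (C c.1 c.2 ?_)
    simp only [Set.mem_prod, Set.mem_Iio] at hcN
    omega
  by_cases hS : S (N, N)
  · exact Or.inl (D.mono fun c hc => hc.2 hS)
  · exact Or.inr (D.mono fun c hc hc' => hS (hc.1 hc'))

end BicyclicMonoid

/-! ### Compact neighbourhoods of (ω^(q+1), ω^(q+1)) and the cells they contain. -/

namespace BicyclicMonoid

variable {α : Ordinal.{u}}

theorem small_up {q j : ℕ} (hq : (q : Ordinal.{u}) < α) (h : q < j) :
    (up hq).fst < ω ^ (j : Ordinal.{u}) ∧ (up hq).snd < ω ^ (j : Ordinal.{u}) :=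
  ⟨(opow_lt_opow_iff_right one_lt_omega0).2 (by exact_mod_cast h), opow_pos _ omega0_pos⟩

theorem small_down {q j : ℕ} (hq : (q : Ordinal.{u}) < α) (h : q < j) :
    (down hq).fst < ω ^ (j : Ordinal.{u}) ∧ (down hq).snd < ω ^ (j : Ordinal.{u}) :=
  (small_up hq h).symm

theorem small_one (j : ℕ) : (1 : BicyclicMonoid α).fst < ω ^ (j : Ordinal.{u}) ∧
    (1 : BicyclicMonoid α).snd < ω ^ (j : Ordinal.{u}) :=
  ⟨opow_pos _ omega0_pos, opow_pos _ omega0_pos⟩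

/-- A set closed under left multiplication by `(ω ^ i, 0)` and `(0, ω ^ i)` for `i < q` is closed
under left multiplication by all `(s, 0)` and `(0, s)` with `s < ω ^ q`. -/
theorem mul_mem_of_up_down {q : ℕ} (hq : (q : Ordinal.{u}) < α) {C : Set (BicyclicMonoid α)}
    (hC : ∀ (i : ℕ) (hi : (i : Ordinal.{u}) < α), i < q → ∀ y ∈ C,
      up hi * y ∈ C ∧ down hi * y ∈ C)
    (s : Ordinal.{u}) (hs : s < ω ^ α) (hsq : s < ω ^ (q : Ordinal.{u})) :
    ∀ y ∈ C, inl s hs * y ∈ C ∧ inr s hs * y ∈ C := by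
  induction s using WellFoundedLT.induction with
  | ind s ih =>
    intro y hy
    by_cases h0 : s = 0
    · subst h0
      have h1 : inl 0 hs = 1 := rfl
      have h2 : inr 0 hs = 1 := rfl
      rw [h1, h2, one_mul]
      exact ⟨hy, hy⟩
    · obtain ⟨i, c, hc, rfl⟩ := eq_add_opow_of_ne_zero h0
      have hi : i < q := (opow_lt_opow_iff_right one_lt_omega0).1 (le_add_self.trans_lt hsq)
      obtain ⟨i, rfl⟩ := lt_omega0.1 (hi.trans (natCast_lt_omega0 q))
      have hiq : i < q := by exact_mod_cast hi
      have hiα := hi.trans hq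
      have e1 : inl _ hs = inl c (hc.trans hs) * up hiα := (inl_mul_inl _ _).symm
      have e2 : inr _ hs = down hiα * inr c (hc.trans hs) := (inr_mul_inr _ _).symm
      rw [e1, e2, mul_assoc, mul_assoc]
      have ih' := ih c hc (hc.trans hs) (hc.trans hsq)
      exact ⟨(ih' _ (hC i hiα hiq y hy).1).1, (hC i hiα hiq _ (ih' y hy).2).2⟩

variable {q : ℕ} (hq : (q : Ordinal.{u}) < α) (hj : ((q + 1 : ℕ) : Ordinal.{u}) < α)

theorem diag_notMem_cell (c : ℕ × ℕ) : diag (q + 1) hj ∉ cell hq c := fun h =>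
  diag_notMem_gridUpset hq hj _ _ h.1

theorem exists_mem_cell_of_mem_ball {x : BicyclicMonoid α} (hx : x ∈ ball hj)
    (hne : x ≠ diag (q + 1) hj) : ∃ c, x ∈ cell hq c := by
  rcases mem_ball.1 hx with h | h
  · exact absurd h hne
  · exact exists_mem_cell hq h.1 h.2

variable [τ : TopologicalSpace (BicyclicMonoid α)] [T2Space (BicyclicMonoid α)]

theorem isClopen_cell (hs : ShiftContinuous τ) {q : ℕ} (hq : (q : Ordinal.{u}) < α)
    (c : ℕ × ℕ) : IsClopen (cell hq c) := by
  obtain ⟨k, l⟩ := c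
  by_cases h : ∃ k' l', k = k' + 1 ∧ l = l' + 1
  · obtain ⟨k, l, rfl, rfl⟩ := h
    have : cell hq (k + 1, l + 1) = gridUpset hq (k + 1) (l + 1) \ gridUpset hq k l := by
      ext x
      refine ⟨fun h => ⟨h.1, h.2 k l rfl rfl⟩, fun h => ⟨h.1, fun k' l' hk hl => ?_⟩⟩
      obtain rfl : k = k' := by simpa using hk
      obtain rfl : l = l' := by simpa using hl
      exact h.2
    rw [this]
    exact (isClopen_upset hs _ _).diff (isClopen_upset hs _ _)
  · have : cell hq (k, l) = gridUpset hq k l := by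
      ext x
      exact ⟨fun h => h.1, fun hx => ⟨hx, fun k' l' hk hl => absurd ⟨k', l', hk, hl⟩ h⟩⟩
    rw [this]
    exact isClopen_upset hs _ _

theorem ball_mem_nhds (hs : ShiftContinuous τ) {j : ℕ} (hj : (j : Ordinal.{u}) < α) :
    ball hj ∈ 𝓝 (diag j hj) :=
  (isClopen_upset hs _ _).isOpen.mem_nhds (mem_ball.2 (Or.inl rfl))

/-- K minus the interior of V is compact and misses the centre, so finitely many of the disjoint
open cells cover it. -/
theorem eventually_mem_of_mem_cell (hs : ShiftContinuous τ) {K V : Set (BicyclicMonoid α)}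
    (hK : IsCompact K) (hKb : K ⊆ ball hj) (hV : V ∈ 𝓝 (diag (q + 1) hj)) :
    ∀ᶠ c in Filter.cofinite, ∀ x ∈ K, x ∈ cell hq c → x ∈ V := by
  obtain ⟨t, ht⟩ := (hK.diff (isOpen_interior (s := V))).elim_finite_subcover (cell hq)
    (fun c => (isClopen_cell hs hq c).isOpen) (fun x hx => by
      obtain ⟨c, hc⟩ := exists_mem_cell_of_mem_ball hq hj (hKb hx.1) (by
        rintro rfl
        exact hx.2 (mem_interior_iff_mem_nhds.2 hV))
      exact Set.mem_iUnion.2 ⟨c, hc⟩)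
  rw [Filter.eventually_cofinite]
  refine t.finite_toSet.subset fun c hc => ?_
  simp only [Set.mem_ofPred_eq, not_forall] at hc
  obtain ⟨x, hxK, hxc, hxV⟩ := hc
  have := ht ⟨hxK, fun h => hxV (interior_subset h)⟩
  simp only [Set.mem_iUnion] at this
  obtain ⟨c', hc', hx⟩ := this
  rw [cell_disjoint hq hxc hx]
  exact hc'

theorem eventually_mul_mem_of_mem_cell (hs : ShiftContinuous τ) {K V : Set (BicyclicMonoid α)}
    (hK : IsCompact K) (hKb : K ⊆ ball hj) (hV : V ∈ 𝓝 (diag (q + 1) hj))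
    {u v : BicyclicMonoid α}
    (hu : u.fst < ω ^ ((q + 1 : ℕ) : Ordinal.{u}) ∧ u.snd < ω ^ ((q + 1 : ℕ) : Ordinal.{u}))
    (hv : v.fst < ω ^ ((q + 1 : ℕ) : Ordinal.{u}) ∧ v.snd < ω ^ ((q + 1 : ℕ) : Ordinal.{u})) :
    ∀ᶠ c in Filter.cofinite, ∀ x ∈ K, x ∈ cell hq c → u * x * v ∈ V :=
  eventually_mem_of_mem_cell hq hj hs hK hKb
    ((hs u v).continuousAt (x := diag (q + 1) hj) (by rwa [mul_diag_mul hj hu hv]))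

section compact

variable {K : Set (BicyclicMonoid α)}

theorem eventually_up_mul_mem (hs : ShiftContinuous τ) (hK : IsCompact K) (hKb : K ⊆ ball hj)
    (hKz : K ∈ 𝓝 (diag (q + 1) hj)) {i : ℕ} (hi : (i : Ordinal.{u}) < α) (hiq : i ≤ q) :
    ∀ᶠ c in Filter.cofinite, ∀ x ∈ K, x ∈ cell hq c → up hi * x ∈ K := by
  simpa using eventually_mul_mem_of_mem_cell hq hj hs hK hKb hKz
    (small_up hi (Nat.lt_succ_of_le hiq)) (small_one _)

theorem eventually_down_mul_mem (hs : ShiftContinuous τ) (hK : IsCompact K) (hKb : K ⊆ ball hj)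
    (hKz : K ∈ 𝓝 (diag (q + 1) hj)) {i : ℕ} (hi : (i : Ordinal.{u}) < α) (hiq : i ≤ q) :
    ∀ᶠ c in Filter.cofinite, ∀ x ∈ K, x ∈ cell hq c → down hi * x ∈ K := by
  simpa using eventually_mul_mem_of_mem_cell hq hj hs hK hKb hKz
    (small_down hi (Nat.lt_succ_of_le hiq)) (small_one _)

theorem eventually_mul_up_mem (hs : ShiftContinuous τ) (hK : IsCompact K) (hKb : K ⊆ ball hj)
    (hKz : K ∈ 𝓝 (diag (q + 1) hj)) :
    ∀ᶠ c in Filter.cofinite, ∀ x ∈ K, x ∈ cell hq c → x * up hq ∈ K := by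
  simpa using eventually_mul_mem_of_mem_cell hq hj hs hK hKb hKz
    (small_one _) (small_up hq (Nat.lt_succ_self q))

theorem eventually_mul_down_mem (hs : ShiftContinuous τ) (hK : IsCompact K) (hKb : K ⊆ ball hj)
    (hKz : K ∈ 𝓝 (diag (q + 1) hj)) :
    ∀ᶠ c in Filter.cofinite, ∀ x ∈ K, x ∈ cell hq c → x * down hq ∈ K := by
  simpa using eventually_mul_mem_of_mem_cell hq hj hs hK hKb hKz
    (small_one _) (small_down hq (Nat.lt_succ_self q))

theorem tendsto_succ_fst : Filter.Tendsto (fun c : ℕ × ℕ => (c.1 + 1, c.2))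
    Filter.cofinite Filter.cofinite :=
  Function.Injective.tendsto_cofinite fun c c' h => by
    simp only [Prod.mk.injEq, Nat.add_right_cancel_iff] at h
    exact Prod.ext h.1 h.2

theorem tendsto_succ_snd : Filter.Tendsto (fun c : ℕ × ℕ => (c.1, c.2 + 1))
    Filter.cofinite Filter.cofinite :=
  Function.Injective.tendsto_cofinite fun c c' h => by
    simp only [Prod.mk.injEq, Nat.add_right_cancel_iff] at h
    exact Prod.ext h.1 h.2

theorem tendsto_prodMk_add (k e : ℕ) : Filter.Tendsto (fun l : ℕ => (k, l + e))
    Filter.cofinite Filter.cofinite :=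
  Function.Injective.tendsto_cofinite fun c c' h => by simpa using h

/-- The set of cells meeting K is almost invariant, hence finite or cofinite. If it were finite,
removing those clopen cells from K would isolate the centre. -/
theorem eventually_inter_cell_nonempty (hs : ShiftContinuous τ)
    (hz : ¬ IsOpen {diag (q + 1) hj}) (hK : IsCompact K) (hKb : K ⊆ ball hj)
    (hKz : K ∈ 𝓝 (diag (q + 1) hj)) :
    ∀ᶠ c in Filter.cofinite, ∃ x ∈ K, x ∈ cell hq c := by
  refine (eventually_cofinite_or ?_ ?_).resolve_right fun h => hz ?_
  · filter_upwards [eventually_up_mul_mem hq hj hs hK hKb hKz hq le_rfl, tendsto_succ_fst.eventually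
      (eventually_down_mul_mem hq hj hs hK hKb hKz hq le_rfl)] with c h1 h2
    exact ⟨fun ⟨x, hx, hxc⟩ => ⟨_, h1 x hx hxc, up_mul_mem_cell hq hxc⟩,
      fun ⟨x, hx, hxc⟩ => ⟨_, h2 x hx hxc, down_mul_mem_cell hq hxc⟩⟩
  · filter_upwards [eventually_mul_down_mem hq hj hs hK hKb hKz, tendsto_succ_snd.eventually
      (eventually_mul_up_mem hq hj hs hK hKb hKz)] with c h1 h2
    exact ⟨fun ⟨x, hx, hxc⟩ => ⟨_, h1 x hx hxc, mul_down_mem_cell hq hxc⟩,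
      fun ⟨x, hx, hxc⟩ => ⟨_, h2 x hx hxc, mul_up_mem_cell hq hxc⟩⟩
  · rw [Filter.eventually_cofinite] at h
    have hI := (Filter.biInter_mem h).2 fun c _ =>
      (isClopen_cell hs hq c).compl.isOpen.mem_nhds (diag_notMem_cell hq hj c)
    rw [isOpen_iff_mem_nhds]
    rintro x rfl
    filter_upwards [hKz, hI] with x hxK hx
    by_contra hne
    obtain ⟨c, hc⟩ := exists_mem_cell_of_mem_ball hq hj (hKb hxK) hne
    exact Set.mem_iInter₂.1 hx c (fun h => h ⟨x, hxK, hc⟩) hc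

/-- For large l the one-point cells (0, l) and (0, l + 1) lie in K. Multiplying these points on the
left by small generators reaches all of the cell (1, l + 1) without leaving the few cells where K is
known to be stable. -/
theorem eventually_cell_one_subset (hs : ShiftContinuous τ)
    (hz : ¬ IsOpen {diag (q + 1) hj}) (hK : IsCompact K) (hKb : K ⊆ ball hj)
    (hKz : K ∈ 𝓝 (diag (q + 1) hj)) :
    ∀ᶠ l in Filter.cofinite, cell hq (1, l + 1) ⊆ K := by
  have hS := eventually_inter_cell_nonempty hq hj hs hz hK hKb hKz
  have hG : ∀ᶠ c in Filter.cofinite, ∀ i : Fin q, ∀ x ∈ K, x ∈ cell hq c →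
      up ((Nat.cast_lt.2 i.2).trans hq) * x ∈ K ∧ down ((Nat.cast_lt.2 i.2).trans hq) * x ∈ K := by
    rw [Filter.eventually_all]
    intro i
    filter_upwards [eventually_up_mul_mem hq hj hs hK hKb hKz ((Nat.cast_lt.2 i.2).trans hq) i.2.le,
      eventually_down_mul_mem hq hj hs hK hKb hKz ((Nat.cast_lt.2 i.2).trans hq) i.2.le]
      with c h1 h2 x hx hxc
    exact ⟨h1 x hx hxc, h2 x hx hxc⟩
  filter_upwards [(tendsto_prodMk_add 0 0).eventually hS, (tendsto_prodMk_add 0 1).eventually hS,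
    (tendsto_prodMk_add 0 0).eventually hG, (tendsto_prodMk_add 1 1).eventually hG,
    (tendsto_prodMk_add 0 1).eventually (eventually_up_mul_mem hq hj hs hK hKb hKz hq le_rfl)]
    with l hS0 hS1 hG0 hG1 hup
  have axis : ∀ n, (∃ x ∈ K, x ∈ cell hq (0, n)) → inr _ (opow_mul_nat_lt' hq n) ∈ K := by
    rintro n ⟨x, hxK, hxc⟩
    rcases mem_cell_cases hq hxc with ⟨h1, h2⟩ | ⟨k, l, -, -, h, -⟩
    · have : inr _ (opow_mul_nat_lt' hq n) = x := by
        ext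
        · simpa using h1.symm
        · exact h2.symm
      rwa [this]
    · simp at h
  -- The pairs (s, ω^q l + t) with s, t < ω^q lie in cell (0, l) or (1, l + 1), so stability of K on
  -- these two cells makes C closed under the generators of level below q. Each such pair is (s,
  -- 0)(0, t)(0, ω^q l).
  let C : Set (BicyclicMonoid α) := {y | y ∈ K ∧ y.fst < ω ^ (q : Ordinal.{u}) ∧
    ∃ t < ω ^ (q : Ordinal.{u}), y.snd = ω ^ (q : Ordinal.{u}) * l + t}
  have hp := isPrincipal_add_omega0_opow.{u} (q : Ordinal.{u})
  have hC : ∀ (i : ℕ) (hi : (i : Ordinal.{u}) < α), i < q → ∀ y ∈ C,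
      up hi * y ∈ C ∧ down hi * y ∈ C := by
    rintro i hi hiq y ⟨hyK, hy, t, ht, hyt⟩
    have hiω := (small_up hi hiq).1
    rw [inl_fst] at hiω
    have hmem : up hi * y ∈ K ∧ down hi * y ∈ K := by
      by_cases hy0 : y ∈ gridUpset hq 0 l
      · exact hG0 ⟨i, hiq⟩ y hyK ⟨hy0, fun _ _ h => by simp at h⟩
      · refine hG1 ⟨i, hiq⟩ y hyK ⟨(mem_gridUpset hq).2 ⟨ω ^ (q : Ordinal.{u}), ?_, ?_⟩, ?_⟩
        · rw [tail_opow hy]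
          simp
        · rw [hyt, add_assoc, tail_opow ht, Nat.cast_succ, mul_add_one]
        · intro k' l' hk hl
          obtain rfl : k' = 0 := by simpa using hk
          obtain rfl : l = l' := by simpa using hl
          exact hy0
    refine ⟨⟨hmem.1, ?_, t, ht, ?_⟩, ⟨hmem.2, ?_, t + (ω ^ (i : Ordinal.{u}) - y.fst), ?_, ?_⟩⟩
    · rw [inl_mul_fst]
      exact hp hiω hy
    · rw [inl_mul_snd, hyt]
    · rw [mul_fst, inr_fst, inr_snd, zero_add]
      exact (Ordinal.sub_le_self _ _).trans_lt hy
    · exact hp ht ((Ordinal.sub_le_self _ _).trans_lt hiω)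
    · rw [mul_snd, inr_snd, hyt, add_assoc]
  have hC0 : inr _ (opow_mul_nat_lt' hq l) ∈ C :=
    ⟨axis l hS0, opow_pos _ omega0_pos, 0, opow_pos _ omega0_pos, by simp⟩
  intro x hx
  rcases mem_cell_cases hq hx with ⟨h1, h2⟩ | ⟨k, l', s, t, hc, hs', ht, h1, h2⟩
  -- The corner (ω^q, ω^q (l + 1)) is not of that form; it is (ω^q, 0) times the point of cell (0, l
  -- + 1).
  · have := hup _ (axis _ hS1) ⟨(mem_gridUpset hq).2 ⟨0, by simp⟩, fun _ _ h => by simp at h⟩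
    convert this
    ext
    · rw [h1, inl_mul_fst]
      simp
    · rw [h2, inl_mul_snd]
      simp
  · simp only [Prod.mk.injEq, Nat.add_right_cancel_iff] at hc
    obtain ⟨hk, rfl⟩ := hc
    obtain rfl : k = 0 := by omega
    have hqα := opow_nat_lt hq
    have := (mul_mem_of_up_down hq hC s (hs'.trans hqα) hs' _
      (mul_mem_of_up_down hq hC t (ht.trans hqα) ht _ hC0).2).1
    convert this.1
    ext
    · rw [h1, inl_mul_fst, mul_fst]
      simp
    · rw [h2, inl_mul_snd, mul_snd]
      simp

theorem eventually_cell_subset_compact (hs : ShiftContinuous τ)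
    (hz : ¬ IsOpen {diag (q + 1) hj}) (hK : IsCompact K) (hKb : K ⊆ ball hj)
    (hKz : K ∈ 𝓝 (diag (q + 1) hj)) :
    ∀ᶠ c in Filter.cofinite, cell hq c ⊆ K := by
  have hS := eventually_inter_cell_nonempty hq hj hs hz hK hKb hKz
  have h1 := eventually_cell_one_subset hq hj hs hz hK hKb hKz
  -- Between cells with both indices positive the grid shifts are bijections, so containment in K is
  -- almost invariant. The cells (1, l + 1) rule out the finite alternative.
  have hF : ∀ᶠ c : ℕ × ℕ in Filter.cofinite, cell hq (c.1 + 1, c.2 + 1) ⊆ K := by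
    have t := tendsto_succ_fst.comp tendsto_succ_snd
    refine (eventually_cofinite_or ?_ ?_).resolve_right fun h => ?_
    · filter_upwards [t.eventually (eventually_up_mul_mem hq hj hs hK hKb hKz hq le_rfl),
        (tendsto_succ_fst.comp t).eventually
          (eventually_down_mul_mem hq hj hs hK hKb hKz hq le_rfl)] with c h1 h2
      refine ⟨fun h x hx => ?_, fun h x hx => ?_⟩
      · rw [← up_mul_down_mul hq hx]
        have := down_mul_mem_cell hq hx
        exact h1 _ (h this) this
      · have hm := up_mul_mem_cell hq hx
        have := h2 _ (h hm) hm
        rwa [← mul_assoc, inr_mul_inl, one_mul] at this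
    · filter_upwards [t.eventually (eventually_mul_down_mem hq hj hs hK hKb hKz),
        (tendsto_succ_snd.comp t).eventually
          (eventually_mul_up_mem hq hj hs hK hKb hKz)] with c h1 h2
      refine ⟨fun h x hx => ?_, fun h x hx => ?_⟩
      · rw [← mul_up_mul_down hq hx]
        have := mul_up_mem_cell hq hx
        exact h1 _ (h this) this
      · have hm := mul_down_mem_cell hq hx
        have := h2 _ (h hm) hm
        rwa [mul_assoc, inr_mul_inl, mul_one] at this
    · obtain ⟨l, hl, hl'⟩ := (h1.and ((tendsto_prodMk_add 0 0).eventually h)).exists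
      exact hl' hl
  rw [Filter.eventually_cofinite] at hS hF ⊢
  refine (hS.union (hF.image fun c => (c.1 + 1, c.2 + 1))).subset fun c hc => ?_
  by_cases h : ∃ c' : ℕ × ℕ, (c'.1 + 1, c'.2 + 1) = c
  · obtain ⟨c', rfl⟩ := h
    exact Or.inr ⟨c', hc, rfl⟩
  -- A cell with a zero index is a single point, so meeting K means lying in K.
  · refine Or.inl fun hne => hc ?_
    have sing : ∀ x ∈ cell hq c, x.fst = ω ^ (q : Ordinal.{u}) * c.1 ∧
        x.snd = ω ^ (q : Ordinal.{u}) * c.2 := fun x hx => by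
      rcases mem_cell_cases hq hx with h' | ⟨k, l, -, -, h', -⟩
      · exact h'
      · exact absurd ⟨(k, l), h'.symm⟩ h
    obtain ⟨x, hxK, hxc⟩ := hne
    intro y hy
    have : y = x := by
      ext
      · rw [(sing x hxc).1, (sing y hy).1]
      · rw [(sing x hxc).2, (sing y hy).2]
    rwa [this]

end compact

variable [LocallyCompactSpace (BicyclicMonoid α)]

theorem exists_compact_ball (hs : ShiftContinuous τ) {j : ℕ} (hj : (j : Ordinal.{u}) < α) :
    ∃ K ∈ 𝓝 (diag j hj), K ⊆ ball hj ∧ IsCompact K :=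
  LocallyCompactSpace.local_compact_nhds _ _ (ball_mem_nhds hs hj)

theorem eventually_cell_subset (hs : ShiftContinuous τ)
    (hz : ¬ IsOpen {diag (q + 1) hj}) {V : Set (BicyclicMonoid α)}
    (hV : V ∈ 𝓝 (diag (q + 1) hj)) : ∀ᶠ c in Filter.cofinite, cell hq c ⊆ V := by
  obtain ⟨K, hKz, hKb, hK⟩ := exists_compact_ball hs hj
  filter_upwards [eventually_cell_subset_compact hq hj hs hz hK hKb hKz,
    eventually_mem_of_mem_cell hq hj hs hK hKb hV] with c h1 h2 x hx
  exact h2 x (h1 hx) hx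

/-! ### The base at a non-isolated point, and inheritance of isolation. -/

/-- If `(ω ^ (q + 1), ω ^ (q + 1))` is not isolated, its neighbourhoods are the prescribed
ones. -/
theorem hasBasis_of_not_isOpen (hs : ShiftContinuous τ)
    (hz : ¬ IsOpen {diag (q + 1) hj}) :
    (𝓝 (diag (q + 1) hj)).HasBasis (fun n : ℕ => 1 ≤ n) (basicNhd (q + 1) hj) := by
  have hq : (q : Ordinal.{u}) < α := lt_trans (by exact_mod_cast Nat.lt_succ_self q) hj
  refine ⟨fun V => ⟨fun hV => ?_, ?_⟩⟩
  · have h := eventually_cell_subset hq hj hs hz hV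
    rw [Filter.eventually_cofinite] at h
    obtain ⟨M, hM⟩ := h.bddAbove
    -- M bounds the indices of the cells not inside V, so a point with a coordinate beyond ω^q (max
    -- + 1) is in none of them; the + 1 also gives n ≥ 1.
    refine ⟨max M.1 M.2 + 1, by omega, ?_⟩
    rintro x (⟨hx1, hx2, hx3⟩ | rfl)
    · obtain ⟨c, hc⟩ := exists_mem_cell hq hx1 hx2
      by_contra hxV
      have hcM := hM (show c ∈ _ from fun hsub => hxV (hsub hc))
      have hle := le_of_mem_gridUpset hq hc.1
      have key : ∀ m : ℕ, m ≤ max M.1 M.2 → (ω : Ordinal.{u}) ^ (q : Ordinal.{u}) * m ≤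
          ω ^ (q : Ordinal.{u}) * ((max M.1 M.2 + 1 : ℕ) : Ordinal.{u}) := fun m hm => by
        gcongr
        omega
      rcases hx3 with hx3 | hx3
      · exact (hle.1.trans (key _ (hcM.1.trans (le_max_left _ _)))).not_gt hx3
      · exact (hle.2.trans (key _ (hcM.2.trans (le_max_right _ _)))).not_gt hx3
    · exact mem_of_mem_nhds hV
  · rintro ⟨n, -, hn⟩
    refine Filter.mem_of_superset ?_ hn
    -- The points of the ball outside the basic set are covered by finitely many closed upsets that
    -- miss the centre.
    have hfin := (Filter.biInter_mem ((Set.finite_Iic (n + 1)).prod (Set.finite_Iic (n + 1)))).2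
      fun c _ => (isClopen_upset hs (opow_mul_nat_lt' hq c.1)
        (opow_mul_nat_lt' hq c.2)).compl.isOpen.mem_nhds (diag_notMem_gridUpset hq hj c.1 c.2)
    filter_upwards [ball_mem_nhds hs hj, hfin] with x hxb hx
    rcases mem_ball.1 hxb with h | ⟨h, h'⟩
    · exact Or.inr h
    · refine Or.inl ⟨h, h', ?_⟩
      by_contra! hle
      obtain ⟨k, l, hk, hl, hkl⟩ := mem_gridUpset_of_le hq hle.1 hle.2
      exact Set.mem_iInter₂.1 hx (k, l) ⟨hk, hl⟩ hkl

/-- Isolation of `(ω ^ j, ω ^ j)` is inherited by larger `j`. -/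
theorem isOpen_diag_succ (hs : ShiftContinuous τ) (hj' : ((q + 1 + 1 : ℕ) : Ordinal.{u}) < α)
    (hz : IsOpen {diag (q + 1) hj}) : IsOpen {diag (q + 1 + 1) hj'} := by
  have hq : (q : Ordinal.{u}) < α := lt_trans (by exact_mod_cast Nat.lt_succ_self q) hj
  by_contra hz'
  obtain ⟨K, hKz, hKb, hK⟩ := exists_compact_ball hs hj'
  obtain ⟨⟨k, l⟩, hc⟩ := ((tendsto_succ_fst.comp tendsto_succ_snd).eventually
    (eventually_cell_subset_compact hj hj' hs hz' hK hKb hKz)).exists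
  replace hc : cell hj (k + 1, l + 1) ⊆ K := hc
  -- A cell of level q + 1 inside K is compact; the shift moves it into the ball around (ω^(q+1),
  -- ω^(q+1)).
  have hE := (hK.of_isClosed_subset (isClopen_cell hs hj _).isClosed hc).image
    (hs (inr _ (opow_mul_nat_lt' hj k)) (inl _ (opow_mul_nat_lt' hj l)))
  have hEb : (fun x => inr _ (opow_mul_nat_lt' hj k) * x * inl _ (opow_mul_nat_lt' hj l)) ''
      cell hj (k + 1, l + 1) ⊆ ball hj := by
    rintro _ ⟨x, hx, rfl⟩
    have hx1 := hx.1
    have e : ∀ n : ℕ, (ω : Ordinal.{u}) ^ ((q + 1 : ℕ) : Ordinal.{u}) * ((n + 1 : ℕ) : Ordinal.{u})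
        = ω ^ ((q + 1 : ℕ) : Ordinal.{u}) * n + ω ^ ((q + 1 : ℕ) : Ordinal.{u}) := fun n => by
      rw [Nat.cast_succ n, mul_add_one]
    rw [mem_gridUpset, e, e, ← mem_upset (add_lt (opow_mul_nat_lt' hj k) (opow_nat_lt hj))
      (add_lt (opow_mul_nat_lt' hj l) (opow_nat_lt hj)), upset, Set.mem_ofPred_eq,
      ← inr_mul_inr (opow_nat_lt hj) (opow_mul_nat_lt' hj k),
      ← inl_mul_inl (opow_mul_nat_lt' hj l) (opow_nat_lt hj)] at hx1
    rw [ball, upset, Set.mem_ofPred_eq, ← hx1]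
    simp only [mul_assoc]
  -- With the isolated point itself as neighbourhood, the compact image can meet only finitely many
  -- level-q cells, yet it contains every grid point except (0, 0). That one is excluded because its
  -- translate lies above the preceding grid point, outside the chosen cell.
  have hev := (eventually_mem_of_mem_cell hq hj hs hE hEb (hz.mem_nhds rfl)).and
    (Set.finite_singleton ((0, 0) : ℕ × ℕ)).eventually_cofinite_notMem
  obtain ⟨⟨m, m'⟩, h, h0⟩ := hev.exists
  have hω : (ω : Ordinal.{u}) ^ (q : Ordinal.{u}) ≠ 0 := (opow_pos _ omega0_pos).ne'
  set y : BicyclicMonoid α := ⟨ω ^ (q : Ordinal.{u}) * m, ω ^ (q : Ordinal.{u}) * m',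
    opow_mul_nat_lt' hq m, opow_mul_nat_lt' hq m'⟩ with hy
  have hyd := h y ?_ (grid_mem_cell hq m m')
  · exact (opow_mul_nat_lt q m).ne (congrArg fst hyd)
  · refine ⟨inl _ (opow_mul_nat_lt' hj k) * y * inr _ (opow_mul_nat_lt' hj l), ⟨?_, ?_⟩, ?_⟩
    · rw [mem_gridUpset]
      refine ⟨ω ^ ((q + 1 : ℕ) : Ordinal.{u}), ?_, ?_⟩
      · rw [mul_inr_fst, inl_mul_fst, add_assoc, tail_opow (opow_mul_nat_lt q m),
          Nat.cast_succ k, mul_add_one]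
      · rw [mul_inr_snd, inl_mul_snd, add_assoc, tail_opow (opow_mul_nat_lt q m'),
          Nat.cast_succ l, mul_add_one]
    · intro k' l' hk hl hmem
      obtain rfl : k = k' := by simpa using hk
      obtain rfl : l = l' := by simpa using hl
      have hle := le_of_mem_gridUpset hj hmem
      rw [mul_inr_fst, inl_mul_fst, mul_inr_snd, inl_mul_snd] at hle
      have key : ∀ a b : Ordinal.{u}, a + b ≤ a → b = 0 := fun a b hab => by
        have : a + b ≤ a + 0 := by simpa using hab
        simpa using (add_le_add_iff_left a).1 this
      have e1 := key _ _ hle.1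
      have e2 := key _ _ hle.2
      refine h0 (Prod.ext ?_ ?_)
      · simpa [hy, hω] using e1
      · simpa [hy, hω] using e2
    · calc inr _ (opow_mul_nat_lt' hj k) *
            (inl _ (opow_mul_nat_lt' hj k) * y * inr _ (opow_mul_nat_lt' hj l)) *
            inl _ (opow_mul_nat_lt' hj l)
          = (inr _ (opow_mul_nat_lt' hj k) * inl _ (opow_mul_nat_lt' hj k)) * y *
            (inr _ (opow_mul_nat_lt' hj l) * inl _ (opow_mul_nat_lt' hj l)) := by
            simp only [mul_assoc]
        _ = y := by rw [inr_mul_inl, inr_mul_inl, one_mul, mul_one]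

end BicyclicMonoid

/-! ### Choice of i and conclusion. -/

namespace BicyclicMonoid

theorem isOpen_diag_mono {α : Ordinal.{u}} {τ : TopologicalSpace (BicyclicMonoid α)}
    (hτ : IsLCShiftTopology τ) {j j' : ℕ} (hj : (j : Ordinal.{u}) < α)
    (hj' : (j' : Ordinal.{u}) < α) (h1 : 1 ≤ j) (hle : j ≤ j') (h : IsOpen[τ] {diag j hj}) :
    IsOpen[τ] {diag j' hj'} := by
  have := hτ.t2
  have := hτ.locallyCompact
  induction j', hle using Nat.le_induction with
  | base => exact h
  | succ n hn ih =>
    obtain ⟨q, rfl⟩ := Nat.exists_eq_add_of_le' (h1.trans hn)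
    have hn' : ((q + 1 : ℕ) : Ordinal.{u}) < α :=
      lt_trans (by exact_mod_cast Nat.lt_succ_self (q + 1)) hj'
    exact isOpen_diag_succ hn' hτ.shift hj' (ih hn')

theorem exists_isTau {α : Ordinal.{u}} (hα₁ : 1 ≤ α) {τ : TopologicalSpace (BicyclicMonoid α)}
    (hτ : IsLCShiftTopology τ) : ∃ i : Ordinal.{u}, 1 ≤ i ∧ i ≤ α ∧ IsTau α i τ := by
  have := hτ.t2
  have := hτ.locallyCompact
  have basis : ∀ (j : ℕ) (hj : (j : Ordinal.{u}) < α), 1 ≤ j → ¬ IsOpen[τ] {diag j hj} →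
      (@nhds _ τ (diag j hj)).HasBasis (fun n : ℕ => 1 ≤ n) (basicNhd j hj) :=
    fun j hj h1 hz => by
      obtain ⟨q, rfl⟩ := Nat.exists_eq_add_of_le' h1
      exact hasBasis_of_not_isOpen hj hτ.shift hz
  -- Here i is the least positive isolated level. If there is none, i = α makes the isolation
  -- condition vacuous.
  by_cases h : ∃ j : ℕ, 1 ≤ j ∧ ∃ hj : (j : Ordinal.{u}) < α, IsOpen[τ] {diag j hj}
  · classical
    obtain ⟨h1, hj, ho⟩ := Nat.find_spec h
    refine ⟨(Nat.find h : ℕ), by exact_mod_cast h1, hj.le, hτ, fun j' hj' hle => ?_,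
      fun j' hj' h1' hlt => basis j' hj' h1' fun ho' => ?_⟩
    · exact isOpen_diag_mono hτ hj hj' h1 (by exact_mod_cast hle) ho
    · exact Nat.find_min h (by exact_mod_cast hlt) ⟨h1', hj', ho'⟩
  · refine ⟨α, hα₁, le_rfl, hτ, fun j' hj' hle => absurd hj' hle.not_gt,
      fun j' hj' h1' _ => basis j' hj' h1' fun ho' => h ⟨j', h1', hj', ho'⟩⟩

end BicyclicMonoid

theorem theorem3 (α : Ordinal.{u}) (hα₁ : 1 ≤ α) (hα : α ≤ ω)
    (τ : TopologicalSpace (BicyclicMonoid α)) (hτ : BicyclicMonoid.IsLCShiftTopology τ) :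
    ∃ i : Ordinal.{u}, 1 ≤ i ∧ i ≤ α ∧ BicyclicMonoid.IsTau α i τ ∧
      ∀ τ' : TopologicalSpace (BicyclicMonoid α), BicyclicMonoid.IsTau α i τ' → τ' = τ := by
  obtain ⟨i, h1, hi, h⟩ := BicyclicMonoid.exists_isTau hα₁ hτ
  exact ⟨i, h1, hi, h, fun τ' h' => h'.unique hα h⟩
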